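/- Let $f:\mathbb{R}^n\to\mathbb{R}$ and $c=(c_1,\dots,c_p):\mathbb{R}^n\to\mathbb{R}^p$ be continuously differentiable, $A\in\mathbb{R}^{\ell\times n}$, $B\in\mathbb{R}^{\ell\times m}$, $b\in\mathbb{R}^\ell$. Write $\nabla c(x)^{\mathsf T}$ for the Jacobian matrix of $c$ at $x$ and $\|\cdot\|$ for the Euclidean norm. For $(r,q)\in\mathbb{R}^n\times\mathbb{R}^\ell$ consider the problem $$(\mathcal P_{r,q})\qquad \min_{x\in\mathbb{R}^n,\ y\in\mathbb{R}^m}\ \bigl\{\, f(x)-r^{\mathsf T}x \;:\; c(x)=0,\ Ax+By=b+q \,\bigr\}.$$ A KKT point of $(\mathcal P_{r,q})$ is a quadruple $(x,y,\mu,\lambda)\in\mathbb{R}^n\times\mathbb{R}^m\times\mathbb{R}^p\times\mathbb{R}^\ell$ with $$\nabla f(x)-r+\nabla c(x)\mu+A^{\mathsf T}\lambda=0,\qquad B^{\mathsf T}\lambda=0,\qquad c(x)=0,\qquad Ax+By=b+q .$$ Let $\theta^*=(x^*,y^*,\mu^*,\lambda^*)$ be a KKT point of $(\mathcal P_{0,0})$,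 and suppose that $f$ and $c$ are twice continuously differentiable on some neighborhood of $x^*$, that the rows of $$C=\begin{bmatrix}\nabla c(x^*)^{\mathsf T} & 0\\ A & B\end{bmatrix}$$ are linearly independent, and that, with $H=\nabla^2 f(x^*)+\sum_j \mu^*_j\nabla^2 c_j(x^*)$, $$z^{\mathsf T}\begin{bmatrix}H&0\\0&0\end{bmatrix}z>0\qquad\text{for all } z\ne 0 \text{ with } Cz=0 .$$ Then there exist $\epsilon_1>0$ and a map $\hat\theta=(\hat x,\hat y,\hat\mu,\hat\lambda)$ on $\{(r,q):\|(r,q)\|<\epsilon_1\}$ such that the following hold. 1. $\hat\theta$ is continuously differentiable on $\{(r,q):\|(r,q)\|<\epsilon_1\}$; $\hat\theta(r,q)$ is a KKT point of $(\mathcal P_{r,q})$ for every such $(r,q)$; and $\hat\theta(0,0)=\theta^*$. Moreover there is $\epsilon_1'>0$ such that, for every $(r,q)\in\mathbb{R}^n\times\mathbb{R}^\ell$, if $\tilde\theta$ is a KKT point of $(\mathcal P_{r,q})$ with $\|\tilde\theta-\theta^*\|<\epsilon_1'$, then $\|(r,q)\|<\epsilon_1$ and $\tilde\theta=\hat\theta(r,q)$.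 2. There are $\epsilon_2\in(0,\epsilon_1]$ and $\epsilon_2'>0$ such that for all $(r,q)$ with $\|(r,q)\|<\epsilon_2$ the point $(\hat x(r,q),\hat y(r,q))$ is feasible for $(\mathcal P_{r,q})$, and $f(\hat x(r,q))-r^{\mathsf T}\hat x(r,q)\le f(x)-r^{\mathsf T}x$ for every feasible point $(x,y)$ of $(\mathcal P_{r,q})$ with $\|(x,y)-(\hat x(r,q),\hat y(r,q))\|<\epsilon_2'$. 3. There are $\rho'>0$ and $\epsilon_3\in(0,\epsilon_1]$ such that for all $(r,q)$ with $\|(r,q)\|<\epsilon_3$ and all $\rho>\rho'$, $$f(x^*)-r^{\mathsf T}x^*\ \ge\ f(\hat x(r,q))-r^{\mathsf T}\hat x(r,q)-\frac{\rho}{8}\|q\|^2+\hat\lambda(r,q)^{\mathsf T}q .$$ -/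

import Mathlib

open scoped Matrix

noncomputable section

/-- Pairs `(x, y)` of primal variables, with the Euclidean norm of `ℝⁿ⁺ᵐ`. -/
abbrev PrimalPoint (n m : ℕ) : Type :=
  WithLp 2 (EuclideanSpace ℝ (Fin n) × EuclideanSpace ℝ (Fin m))

/-- Pairs `(μ, λ)` of multipliers, with the Euclidean norm of `ℝᵖ⁺ˡ`. -/
abbrev DualPoint (p l : ℕ) : Type :=
  WithLp 2 (EuclideanSpace ℝ (Fin p) × EuclideanSpace ℝ (Fin l))

/-- Quadruples `(x, y, μ, λ)`, grouped as `((x, y), (μ, λ))`, with the Euclidean norm. -/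
abbrev PrimalDualPoint (n m p l : ℕ) : Type :=
  WithLp 2 (PrimalPoint n m × DualPoint p l)

/-- Perturbations `(r, q) ∈ ℝⁿ × ℝˡ`, with the Euclidean norm of `ℝⁿ⁺ˡ`. -/
abbrev Perturbation (n l : ℕ) : Type :=
  WithLp 2 (EuclideanSpace ℝ (Fin n) × EuclideanSpace ℝ (Fin l))

namespace PrimalDualPoint

variable {n m p l : ℕ}

/-- The primal part `(x, y)` of `(x, y, μ, λ)`. -/
abbrev primal (θ : PrimalDualPoint n m p l) : PrimalPoint n m := θ.fst

/-- The component `x` of `(x, y, μ, λ)`. -/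
abbrev x (θ : PrimalDualPoint n m p l) : EuclideanSpace ℝ (Fin n) := θ.fst.fst

/-- The component `y` of `(x, y, μ, λ)`. -/
abbrev y (θ : PrimalDualPoint n m p l) : EuclideanSpace ℝ (Fin m) := θ.fst.snd

/-- The component `μ` of `(x, y, μ, λ)`. -/
abbrev mu (θ : PrimalDualPoint n m p l) : EuclideanSpace ℝ (Fin p) := θ.snd.fst

/-- The component `λ` of `(x, y, μ, λ)`. -/
abbrev lam (θ : PrimalDualPoint n m p l) : EuclideanSpace ℝ (Fin l) := θ.snd.snd

end PrimalDualPoint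

/-- The Jacobian matrix of `c` at `x`: the entry `(j, i)` is `∂c_j/∂x_i`. -/
def jacobianMatrix {n p : ℕ} (c : EuclideanSpace ℝ (Fin n) → EuclideanSpace ℝ (Fin p))
    (x : EuclideanSpace ℝ (Fin n)) : Matrix (Fin p) (Fin n) ℝ :=
  Matrix.of fun j i => fderiv ℝ c x (EuclideanSpace.single i 1) j

/-- The Hessian matrix of `g` at `x`: the entry `(i, k)` is `∂²g/∂x_i∂x_k`. -/
def hessianMatrix {n : ℕ} (g : EuclideanSpace ℝ (Fin n) → ℝ)
    (x : EuclideanSpace ℝ (Fin n)) : Matrix (Fin n) (Fin n) ℝ :=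
  Matrix.of fun i k =>
    fderiv ℝ (fderiv ℝ g) x (EuclideanSpace.single i 1) (EuclideanSpace.single k 1)

/-- The data of the problem `min f(x)` subject to `c(x) = 0`, `A x + B y = b`. -/
structure SplitProblem (n m p l : ℕ) where
  f : EuclideanSpace ℝ (Fin n) → ℝ
  c : EuclideanSpace ℝ (Fin n) → EuclideanSpace ℝ (Fin p)
  A : Matrix (Fin l) (Fin n) ℝ
  B : Matrix (Fin l) (Fin m) ℝ
  b : EuclideanSpace ℝ (Fin l)

namespace SplitProblem

variable {n m p l : ℕ}

/-- The problem `min f(x) - rᵀx` subject to `c(x) = 0`, `A x + B y = b + q`, for `w = (r, q)`. -/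
def perturb (P : SplitProblem n m p l) (w : Perturbation n l) : SplitProblem n m p l where
  f := fun x => P.f x - inner ℝ w.fst x
  c := P.c
  A := P.A
  B := P.B
  b := P.b + w.snd

/-- The set of feasible points `(x, y)`. -/
def feasibleSet (P : SplitProblem n m p l) : Set (PrimalPoint n m) :=
  {z | P.c z.fst = 0 ∧ P.A.toEuclideanLin z.fst + P.B.toEuclideanLin z.snd = P.b}

/-- `(x, y, μ, λ)` is a KKT point: `∇f(x) + ∇c(x) μ + Aᵀλ = 0`, `Bᵀλ = 0`, and `(x, y)` is
feasible. Here `∇c(x)` is the transpose of the Jacobian matrix. -/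
structure IsKKT (P : SplitProblem n m p l) (θ : PrimalDualPoint n m p l) : Prop where
  stationary_x : gradient P.f θ.x + (jacobianMatrix P.c θ.x)ᵀ.toEuclideanLin θ.mu
    + P.Aᵀ.toEuclideanLin θ.lam = 0
  stationary_y : P.Bᵀ.toEuclideanLin θ.lam = 0
  feasible : θ.primal ∈ P.feasibleSet

/-- `z = (x, y)` is a minimizer of the problem on the open `ε`-neighborhood of `z`: it is feasible,
and no feasible point at distance less than `ε` has a smaller objective value. -/
def IsMinimizerOnNhd (P : SplitProblem n m p l) (ε : ℝ) (z : PrimalPoint n m) : Prop :=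
  z ∈ P.feasibleSet ∧ IsMinOn (fun v : PrimalPoint n m => P.f v.fst)
    (P.feasibleSet ∩ Metric.ball z ε) z

/-- The Jacobian matrix `[∇c(x)ᵀ 0; A B]` of all the constraints. -/
def constraintJacobian (P : SplitProblem n m p l) (x : EuclideanSpace ℝ (Fin n)) :
    Matrix (Fin p ⊕ Fin l) (Fin n ⊕ Fin m) ℝ :=
  Matrix.fromBlocks (jacobianMatrix P.c x) 0 P.A P.B

/-- `H_xx(x, μ) = ∇²f(x) + ∑ⱼ μⱼ ∇²cⱼ(x)`. -/
def lagrangianHessian (P : SplitProblem n m p l) (x : EuclideanSpace ℝ (Fin n))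
    (mu : EuclideanSpace ℝ (Fin p)) : Matrix (Fin n) (Fin n) ℝ :=
  hessianMatrix P.f x + ∑ j, mu j • hessianMatrix (fun x' => P.c x' j) x

/-- The regularity assumption at `θ = (x*, y*, μ*, λ*)`: smoothness of `f` and `c`, the KKT
conditions, the linear independence constraint qualification, and the second-order sufficient
condition. -/
structure IsRegularAt (P : SplitProblem n m p l) (θ : PrimalDualPoint n m p l) : Prop where
  contDiff_f : ContDiff ℝ 1 P.f
  contDiff_c : ContDiff ℝ 1 P.c
  isKKT : P.IsKKT θ
  contDiffOn_two : ∃ U : Set (EuclideanSpace ℝ (Fin n)), IsOpen U ∧ θ.x ∈ U ∧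
    ContDiffOn ℝ 2 P.f U ∧ ContDiffOn ℝ 2 P.c U
  licq : LinearIndependent ℝ (P.constraintJacobian θ.x).row
  second_order : ∀ z : Fin n ⊕ Fin m → ℝ, z ≠ 0 → P.constraintJacobian θ.x *ᵥ z = 0 →
    0 < z ⬝ᵥ (Matrix.fromBlocks (P.lagrangianHessian θ.x θ.mu) 0 0 0 *ᵥ z)

end SplitProblem

end

/-! With `z = (x, y)`, `g z = f x` and `G z = (c x, Ax + By - b)`, the KKT points of every perturbed
problem are the solutions of a single equation `kktMap g G θ = kktValue w`: its left side does not
depend on `w`, and its right side is linear in `w = (r, q)`. The derivative of `kktMap` at `θ*` is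
injective by the two regularity assumptions, hence invertible by dimension. The inverse function
theorem (`exists_localInverse_kktMap`) gives a local inverse `φ`, and composing `φ` with `kktValue`
gives the solution map and its local uniqueness.

The other two claims are instances of one inequality. Write `L(z, η) = g z + ⟪η, G z⟫`. Near `θ*`,
uniformly in `z`, `z'` and `η`, `L(z, η) ≥ L(z', η) + D_z L(z', η)(z - z') - K ‖G z - G z'‖²`
(`exists_lagrangian_ge`). It holds because the second derivative of `L` at `θ*` becomes positive
definite after adding a multiple of `‖DG d‖²` (`exists_mul_norm_sq_le_add_of_pos_on_ker`). Let `(z',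
η)` be the KKT point for `w`, where `D_z L` is the pairing with `r`. A feasible `z` of the same
problem has `G z = G z'`, which gives local minimality on a uniform ball. The choice `z = (x*, y*)`,
with `G z = 0`, gives the last bound with `ρ' = 8K`. -/

/-! ### Equality-constrained problems in abstract form. -/

section EqualityConstrained

open Filter Topology

variable {E D : Type*} [NormedAddCommGroup E] [NormedSpace ℝ E]
  [NormedAddCommGroup D] [InnerProductSpace ℝ D]

/-- The derivative in `z` of the Lagrangian `g z + ⟪η, G z⟫`, at `(z, η)`. -/
noncomputable def lagrangianDeriv (g : E → ℝ) (G : E → D) (θ : E × D) : E →L[ℝ] ℝ :=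
  fderiv ℝ g θ.1 + (innerSL ℝ θ.2).comp (fderiv ℝ G θ.1)

/-- The second derivative in `z` of the Lagrangian `g z + ⟪η, G z⟫`, at `(z, η)`. -/
noncomputable def lagrangianSecondDeriv (g : E → ℝ) (G : E → D) (θ : E × D) :
    E →L[ℝ] E →L[ℝ] ℝ :=
  fderiv ℝ (fderiv ℝ g) θ.1 +
    (ContinuousLinearMap.compL ℝ E D ℝ (innerSL ℝ θ.2)).comp (fderiv ℝ (fderiv ℝ G) θ.1)

/-- The map whose zeros are the KKT points of `min g` subject to `G = 0`. -/
noncomputable def kktMap (g : E → ℝ) (G : E → D) (θ : E × D) : (E →L[ℝ] ℝ) × D :=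
  (lagrangianDeriv g G θ, G θ.1)

variable {g : E → ℝ} {G : E → D} {θ₀ : E × D}

lemma lagrangianDeriv_apply (g : E → ℝ) (G : E → D) (θ : E × D) (d : E) :
    lagrangianDeriv g G θ d = fderiv ℝ g θ.1 d + inner ℝ θ.2 (fderiv ℝ G θ.1 d) := rfl

lemma lagrangianSecondDeriv_apply (g : E → ℝ) (G : E → D) (θ : E × D) (d e : E) :
    lagrangianSecondDeriv g G θ d e = fderiv ℝ (fderiv ℝ g) θ.1 d e +
      inner ℝ θ.2 (fderiv ℝ (fderiv ℝ G) θ.1 d e) := rfl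

lemma contDiffAt_lagrangianDeriv (hg : ContDiffAt ℝ 2 g θ₀.1) (hG : ContDiffAt ℝ 2 G θ₀.1) :
    ContDiffAt ℝ 1 (lagrangianDeriv g G) θ₀ := by
  have h1 : ContDiffAt ℝ 1 (fderiv ℝ g) θ₀.1 := hg.fderiv_right (by norm_num)
  have h2 : ContDiffAt ℝ 1 (fderiv ℝ G) θ₀.1 := hG.fderiv_right (by norm_num)
  refine ContDiffAt.add (h1.comp θ₀ contDiffAt_fst) (ContDiffAt.clm_comp ?_
    (h2.comp θ₀ contDiffAt_fst))
  exact (innerSL ℝ (E := D)).contDiff.contDiffAt.comp θ₀ contDiffAt_snd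

lemma contDiffAt_kktMap (hg : ContDiffAt ℝ 2 g θ₀.1) (hG : ContDiffAt ℝ 2 G θ₀.1) :
    ContDiffAt ℝ 1 (kktMap g G) θ₀ :=
  (contDiffAt_lagrangianDeriv hg hG).prodMk
    ((hG.of_le (by norm_num)).comp θ₀ contDiffAt_fst)

lemma fderiv_lagrangianDeriv_apply (hg : ContDiffAt ℝ 2 g θ₀.1) (hG : ContDiffAt ℝ 2 G θ₀.1)
    (d u : E) (e : D) :
    fderiv ℝ (lagrangianDeriv g G) θ₀ (d, e) u =
      lagrangianSecondDeriv g G θ₀ d u + inner ℝ e (fderiv ℝ G θ₀.1 u) := by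
  have h1 : HasFDerivAt (fderiv ℝ g) (fderiv ℝ (fderiv ℝ g) θ₀.1) θ₀.1 :=
    ((hg.fderiv_right (m := 1) (by norm_num)).differentiableAt (by norm_num)).hasFDerivAt
  have h2 : HasFDerivAt (fderiv ℝ G) (fderiv ℝ (fderiv ℝ G) θ₀.1) θ₀.1 :=
    ((hG.fderiv_right (m := 1) (by norm_num)).differentiableAt (by norm_num)).hasFDerivAt
  have h3 : HasFDerivAt (fun θ : E × D => innerSL ℝ θ.2)
      ((innerSL ℝ (E := D)).comp (ContinuousLinearMap.snd ℝ E D)) θ₀ :=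
    (innerSL ℝ (E := D)).hasFDerivAt.comp θ₀ hasFDerivAt_snd
  have h := (h1.comp θ₀ hasFDerivAt_fst).add (h3.clm_comp (h2.comp θ₀ hasFDerivAt_fst))
  have h' : HasFDerivAt (lagrangianDeriv g G) _ θ₀ := h
  rw [h'.fderiv, lagrangianSecondDeriv_apply]
  simp [add_assoc]

/-- A form that is positive on the kernel of `J` becomes positive definite after adding a
multiple of `‖J d‖²`. -/
lemma exists_mul_norm_sq_le_add_of_pos_on_ker [FiniteDimensional ℝ E] (Q : E →L[ℝ] E →L[ℝ] ℝ)
    (J : E →L[ℝ] D) (hQ : ∀ d, d ≠ 0 → J d = 0 → 0 < Q d d) :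
    ∃ α > 0, ∃ K > 0, ∀ d, α * ‖d‖ ^ 2 ≤ Q d d + K * ‖J d‖ ^ 2 := by
  have hS : IsCompact (Metric.sphere (0 : E) 1) := isCompact_sphere 0 1
  -- These open sets increase with `k` and cover the unit sphere: on the kernel by `hQ`, off it
  -- because the penalty grows without bound. By compactness one `k` suffices. Using `k + 1` keeps
  -- the penalty constant positive.
  obtain ⟨N, hN⟩ := hS.elim_directed_cover
    (fun k : ℕ => {d : E | 0 < Q d d + ((k : ℝ) + 1) * ‖J d‖ ^ 2})
    (fun k => isOpen_lt continuous_const (by fun_prop))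
    (fun d hd => by
      have hd0 : d ≠ 0 := by
        rintro rfl; simp at hd
      by_cases hJ : J d = 0
      · exact Set.mem_iUnion.2 ⟨0, by simpa [hJ] using hQ d hd0 hJ⟩
      · have hp : 0 < ‖J d‖ ^ 2 := by positivity
        obtain ⟨k, hk⟩ := exists_nat_gt (-(Q d d) / ‖J d‖ ^ 2)
        refine Set.mem_iUnion.2 ⟨k, ?_⟩
        rw [div_lt_iff₀ hp] at hk
        simp only [Set.mem_ofPred_eq]
        linarith)
    (directed_of_isDirected_le fun i j hij d hd => by
      simp only [Set.mem_ofPred_eq] at hd ⊢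
      have : (i : ℝ) ≤ j := by exact_mod_cast hij
      nlinarith [sq_nonneg ‖J d‖])
  obtain ⟨α, hα, hmin⟩ : ∃ α > 0, ∀ d ∈ Metric.sphere (0 : E) 1,
      α ≤ Q d d + ((N : ℝ) + 1) * ‖J d‖ ^ 2 := by
    -- The sphere is empty when `E` is trivial.
    rcases (Metric.sphere (0 : E) 1).eq_empty_or_nonempty with h | h
    · exact ⟨1, one_pos, by simp [h]⟩
    · obtain ⟨d₀, hd₀, hm⟩ := hS.exists_isMinOn h
        (f := fun d => Q d d + ((N : ℝ) + 1) * ‖J d‖ ^ 2) (by fun_prop)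
      exact ⟨_, hN hd₀, fun d hd => hm hd⟩
  refine ⟨α, hα, (N : ℝ) + 1, by positivity, fun d => ?_⟩
  by_cases hd : d = 0
  · simp [hd]
  have hn : 0 < ‖d‖ := norm_pos_iff.2 hd
  -- Both sides are homogeneous of degree two, so the bound extends from the sphere.
  have h := hmin (‖d‖⁻¹ • d) (by simp [norm_smul, hn.ne'])
  simp only [map_smul, smul_apply, smul_eq_mul, norm_smul, norm_inv,
    norm_norm] at h
  have h2 := mul_le_mul_of_nonneg_right h (sq_nonneg ‖d‖)
  calc _ ≤ _ := h2
    _ = _ := by field_simp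

/-- Second-order lower estimate of the Lagrangian, uniform near a point at which its second
derivative is positive on the kernel of the derivative of `G`. -/
lemma exists_lagrangian_ge [FiniteDimensional ℝ E]
    (hg1 : Differentiable ℝ g) (hG1 : Differentiable ℝ G)
    (hg : ContDiffAt ℝ 2 g θ₀.1) (hG : ContDiffAt ℝ 2 G θ₀.1)
    (hQ : ∀ d, d ≠ 0 → fderiv ℝ G θ₀.1 d = 0 → 0 < lagrangianSecondDeriv g G θ₀ d d) :
    ∃ K > 0, ∃ δ > 0, ∀ z z' : E, ∀ η : D, ‖z - θ₀.1‖ < δ → ‖z' - θ₀.1‖ < δ → ‖η - θ₀.2‖ < δ →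
      g z' + inner ℝ η (G z') + lagrangianDeriv g G (z', η) (z - z') - K * ‖G z - G z'‖ ^ 2
        ≤ g z + inner ℝ η (G z) := by
  obtain ⟨α, hα, K, hK, hfin⟩ := exists_mul_norm_sq_le_add_of_pos_on_ker _ _ hQ
  -- Strict differentiability controls increments between any two nearby points. This makes the
  -- estimate uniform in `z'` and `η` while second derivatives are taken only at `θ₀`.
  have hsL : HasStrictFDerivAt (lagrangianDeriv g G) (fderiv ℝ (lagrangianDeriv g G) θ₀) θ₀ :=
    (contDiffAt_lagrangianDeriv hg hG).hasStrictFDerivAt (by norm_num)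
  have hsG : HasStrictFDerivAt G (fderiv ℝ G θ₀.1) θ₀.1 := hG.hasStrictFDerivAt (by norm_num)
  -- Replacing `DG d` by `G z - G z'` costs `2 K β² ‖d‖²`, which this choice makes `α / 2 * ‖d‖²`.
  -- The other half of `α` absorbs the error in `lagrangianDeriv`.
  obtain ⟨β, hβ, hβ2⟩ : ∃ β : ℝ, 0 < β ∧ 4 * K * β ^ 2 = α :=
    ⟨√(α / (4 * K)), by positivity, by rw [Real.sq_sqrt (by positivity)]; field_simp⟩
  obtain ⟨δ₁, hδ₁, h1⟩ := Metric.eventually_nhds_iff.1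
    (hsL.isLittleO.def (c := α / 2) (by positivity))
  obtain ⟨δ₂, hδ₂, h2⟩ := Metric.eventually_nhds_iff.1 (hsG.isLittleO.def hβ)
  refine ⟨K, hK, min δ₁ δ₂, by positivity, fun z z' η hz hz' hη => ?_⟩
  set d := z - z' with hd
  have hJ : ‖G z - G z' - fderiv ℝ G θ₀.1 d‖ ≤ β * ‖d‖ := by
    refine h2 (y := (z, z')) ?_
    rw [Prod.dist_eq, dist_eq_norm, dist_eq_norm]
    exact (max_lt hz hz').trans_le (min_le_right _ _)
  have hJ2 : ‖fderiv ℝ G θ₀.1 d‖ ^ 2 ≤ 2 * ‖G z - G z'‖ ^ 2 + 2 * β ^ 2 * ‖d‖ ^ 2 := by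
    have : ‖fderiv ℝ G θ₀.1 d‖ ≤ ‖G z - G z'‖ + β * ‖d‖ := by
      have := norm_sub_le (G z - G z') (G z - G z' - fderiv ℝ G θ₀.1 d)
      rw [sub_sub_cancel] at this
      linarith
    have h3 := pow_le_pow_left₀ (norm_nonneg _) this 2
    nlinarith [sq_nonneg (‖G z - G z'‖ - β * ‖d‖)]
  have hline : ∀ s ∈ Set.Icc (0 : ℝ) 1, s * (lagrangianSecondDeriv g G θ₀ d d - α / 2 * ‖d‖ ^ 2) ≤
      lagrangianDeriv g G (z' + s • d, η) d - lagrangianDeriv g G (z', η) d := by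
    intro s hs
    have hzs : ‖z' + s • d - θ₀.1‖ < min δ₁ δ₂ := by
      have := (convex_ball θ₀.1 (min δ₁ δ₂)).add_smul_sub_mem
        (mem_ball_iff_norm.2 hz') (mem_ball_iff_norm.2 hz) hs
      exact mem_ball_iff_norm.1 this
    have h := h1 (y := ((z' + s • d, η), (z', η))) (by
      simp only [dist_eq_norm]
      exact (max_lt (max_lt hzs hη) (max_lt hz' hη)).trans_le (min_le_left _ _))
    have he : ((z' + s • d, η) - (z', η) : E × D) = s • (d, 0) := by simp
    simp only [he] at h
    have h' := ContinuousLinearMap.le_of_opNorm_le _ h d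
    rw [map_smul] at h'
    simp only [sub_apply, smul_apply,
      fderiv_lagrangianDeriv_apply hg hG, inner_zero_left, add_zero, smul_eq_mul, norm_smul,
      Prod.norm_mk, norm_zero, Real.norm_eq_abs, abs_of_nonneg hs.1,
      max_eq_left (norm_nonneg d)] at h'
    have := (abs_le.1 h').1
    linarith
  set q := lagrangianSecondDeriv g G θ₀ d d - α / 2 * ‖d‖ ^ 2
  -- The Lagrangian along the segment minus a quadratic model. By `hline` its derivative is
  -- nonnegative on the segment, so comparing endpoints leaves a second-order term `q / 2`.
  let φ : ℝ → ℝ := fun s => g (z' + s • d) + inner ℝ η (G (z' + s • d))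
    - s * lagrangianDeriv g G (z', η) d - s ^ 2 / 2 * q
  have hφ : ∀ s, HasDerivAt φ (lagrangianDeriv g G (z' + s • d, η) d
      - lagrangianDeriv g G (z', η) d - s * q) s := by
    intro s
    have hp : HasDerivAt (fun s : ℝ => z' + s • d) d s := by
      simpa using ((hasDerivAt_id s).smul_const d).const_add z'
    have a1 : HasDerivAt (fun s : ℝ => g (z' + s • d)) _ s :=
      (hg1 _).hasFDerivAt.comp_hasDerivAt s hp
    have a2 : HasDerivAt (fun s : ℝ => G (z' + s • d)) _ s :=
      (hG1 _).hasFDerivAt.comp_hasDerivAt s hp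
    have a3 : HasDerivAt (fun s : ℝ => inner ℝ η (G (z' + s • d))) _ s :=
      (innerSL ℝ η).hasFDerivAt.comp_hasDerivAt s a2
    have a4 := ((a1.add a3).sub ((hasDerivAt_id s).mul_const
      (lagrangianDeriv g G (z', η) d))).sub ((((hasDerivAt_id s).pow 2).div_const 2).mul_const q)
    refine a4.congr_deriv ?_
    rw [lagrangianDeriv_apply g G (z' + s • d, η)]
    simp
  have hmono : MonotoneOn φ (Set.Icc 0 1) := by
    refine monotoneOn_of_deriv_nonneg (convex_Icc 0 1)
      (fun s _ => (hφ s).continuousAt.continuousWithinAt)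
      (fun s _ => (hφ s).differentiableAt.differentiableWithinAt) fun s hs => ?_
    rw [interior_Icc] at hs
    rw [(hφ s).deriv]
    linarith [hline s ⟨hs.1.le, hs.2.le⟩]
  have h01 := hmono (Set.left_mem_Icc.2 zero_le_one) (Set.right_mem_Icc.2 zero_le_one) zero_le_one
  simp only [φ, zero_smul, one_smul, add_zero] at h01
  rw [show z' + d = z by simp [hd]] at h01
  -- Together with `hfin d` this gives `q ≥ -2 K ‖G z - G z'‖²`; halving it yields exactly the
  -- constant `K`.
  have h3 := mul_le_mul_of_nonneg_left hJ2 hK.le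
  have h4 : K * (2 * ‖G z - G z'‖ ^ 2 + 2 * β ^ 2 * ‖d‖ ^ 2)
      = 2 * (K * ‖G z - G z'‖ ^ 2) + α / 2 * ‖d‖ ^ 2 := by rw [← hβ2]; ring
  have h5 : q = lagrangianSecondDeriv g G θ₀ d d - α / 2 * ‖d‖ ^ 2 := rfl
  linarith [hfin d]

/-- The KKT system is locally invertible, with a continuously differentiable inverse, under the
linear independence constraint qualification and the second-order sufficient condition. -/
lemma exists_localInverse_kktMap [FiniteDimensional ℝ E] [FiniteDimensional ℝ D]
    (hg : ContDiffAt ℝ 2 g θ₀.1) (hG : ContDiffAt ℝ 2 G θ₀.1)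
    (hJ : ∀ e : D, (∀ u, inner ℝ e (fderiv ℝ G θ₀.1 u) = 0) → e = 0)
    (hQ : ∀ d, d ≠ 0 → fderiv ℝ G θ₀.1 d = 0 → 0 < lagrangianSecondDeriv g G θ₀ d d) :
    ∃ φ : (E →L[ℝ] ℝ) × D → E × D, ContDiffAt ℝ 1 φ (kktMap g G θ₀) ∧
      φ (kktMap g G θ₀) = θ₀ ∧ (∀ᶠ v in 𝓝 (kktMap g G θ₀), kktMap g G (φ v) = v) ∧
      ∀ᶠ θ in 𝓝 θ₀, φ (kktMap g G θ) = θ := by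
  have hF := contDiffAt_kktMap hg hG
  have hL := contDiffAt_lagrangianDeriv hg hG
  set L := (fderiv ℝ (lagrangianDeriv g G) θ₀).prod
    ((fderiv ℝ G θ₀.1).comp (ContinuousLinearMap.fst ℝ E D))
  have hd : HasFDerivAt (kktMap g G) L θ₀ :=
    ((hL.differentiableAt (by norm_num)).hasFDerivAt).prodMk
      (((hG.differentiableAt (by norm_num)).hasFDerivAt).comp θ₀ hasFDerivAt_fst)
  -- For `(d, e)` in the kernel, `DG d = 0`, so testing the first component on `d` leaves only the
  -- second-order form, which forces `d = 0`. Then `e` is orthogonal to the range of `DG`, so `e =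
  -- 0`.
  have hinj : Function.Injective (L : E × D →ₗ[ℝ] (E →L[ℝ] ℝ) × D) := by
    refine (injective_iff_map_eq_zero _).2 fun v hv => ?_
    obtain ⟨d, e⟩ := v
    have h1 : fderiv ℝ (lagrangianDeriv g G) θ₀ (d, e) = 0 := congrArg Prod.fst hv
    have h2 : fderiv ℝ G θ₀.1 d = 0 := congrArg Prod.snd hv
    have h1' : ∀ u, lagrangianSecondDeriv g G θ₀ d u + inner ℝ e (fderiv ℝ G θ₀.1 u) = 0 := by
      intro u
      rw [← fderiv_lagrangianDeriv_apply hg hG, h1]; rfl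
    have hd0 : d = 0 := by
      by_contra hne
      have := h1' d
      rw [h2, inner_zero_right, add_zero] at this
      exact (hQ d hne h2).ne' this
    subst hd0
    have he : e = 0 := hJ e fun u => by simpa using h1' u
    rw [he]; rfl
  have hrank : Module.finrank ℝ (E × D) = Module.finrank ℝ ((E →L[ℝ] ℝ) × D) := by
    have h := (LinearMap.toContinuousLinearMap (𝕜 := ℝ) (E := E) (F' := ℝ)).finrank_eq
    have h' : Module.finrank ℝ (E →ₗ[ℝ] ℝ) = Module.finrank ℝ E := Subspace.dual_finrank_eq
    rw [Module.finrank_prod, Module.finrank_prod, ← h, h']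
  let e := (LinearEquiv.ofInjectiveOfFinrankEq (L : E × D →ₗ[ℝ] (E →L[ℝ] ℝ) × D) hinj
    hrank).toContinuousLinearEquiv
  have he : HasFDerivAt (kktMap g G) (e : E × D →L[ℝ] (E →L[ℝ] ℝ) × D) θ₀ := by
    convert! hd
  have : CompleteSpace (E × D) := FiniteDimensional.complete ℝ _
  have hs := hF.hasStrictFDerivAt' he one_ne_zero
  exact ⟨hF.localInverse he one_ne_zero, hF.to_localInverse he one_ne_zero,
    hF.localInverse_apply_image he one_ne_zero, hs.eventually_right_inverse,
    hs.eventually_left_inverse⟩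

end EqualityConstrained

/-! ### Derivatives of compositions with continuous linear maps. -/

section Calculus

variable {E F W : Type*} [NormedAddCommGroup E] [NormedSpace ℝ E]
  [NormedAddCommGroup F] [NormedSpace ℝ F] [NormedAddCommGroup W] [NormedSpace ℝ W]

lemma fderiv_comp_clm (M : E →L[ℝ] F) {h : F → W} (x : E) (h1 : Differentiable ℝ h) :
    fderiv ℝ (fun y => h (M y)) x = (fderiv ℝ h (M x)).comp M :=
  ((h1 (M x)).hasFDerivAt.comp x M.hasFDerivAt).fderiv

lemma fderiv_clm_sub_const (M : E →L[ℝ] F) (b : F) (x : E) :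
    fderiv ℝ (fun y => M y - b) x = M :=
  (M.hasFDerivAt.sub_const b).fderiv

lemma fderiv_fderiv_clm_comp_apply (L : F →L[ℝ] W) {h : E → F} {x : E} (h1 : Differentiable ℝ h)
    (h2 : DifferentiableAt ℝ (fderiv ℝ h) x) (u v : E) :
    fderiv ℝ (fderiv ℝ fun y => L (h y)) x u v = L (fderiv ℝ (fderiv ℝ h) x u v) := by
  have e : fderiv ℝ (fun y => L (h y)) = fun y => L.comp (fderiv ℝ h y) :=
    funext fun y => (L.hasFDerivAt.comp y (h1 y).hasFDerivAt).fderiv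
  have := ((ContinuousLinearMap.compL ℝ E F W L).hasFDerivAt.comp x h2.hasFDerivAt).fderiv
  rw [e]
  exact congrArg (fun T : E →L[ℝ] E →L[ℝ] W => T u v) this

lemma fderiv_fderiv_comp_clm_apply (M : E →L[ℝ] F) {h : F → W} {x : E} (h1 : Differentiable ℝ h)
    (h2 : DifferentiableAt ℝ (fderiv ℝ h) (M x)) (u v : E) :
    fderiv ℝ (fderiv ℝ fun y => h (M y)) x u v = fderiv ℝ (fderiv ℝ h) (M x) (M u) (M v) := by
  have e : fderiv ℝ (fun y => h (M y)) = fun y => (fderiv ℝ h (M y)).comp M :=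
    funext fun y => fderiv_comp_clm M y h1
  have := (((ContinuousLinearMap.compL ℝ E F W).flip M).hasFDerivAt.comp x
    (h2.hasFDerivAt.comp x M.hasFDerivAt)).fderiv
  rw [e]
  exact congrArg (fun T : E →L[ℝ] E →L[ℝ] W => T u v) this

end Calculus

/-! ### Smoothness and derivatives in Euclidean products. -/

section WithLpProd

variable {X E F : Type*} [NormedAddCommGroup X] [NormedSpace ℝ X]
  [NormedAddCommGroup E] [InnerProductSpace ℝ E] [NormedAddCommGroup F] [InnerProductSpace ℝ F]
  {k : WithTop ℕ∞} {u : X → E} {v : X → F} {x : X}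

lemma contDiff_withLp_fst : ContDiff ℝ k fun z : WithLp 2 (E × F) => z.fst :=
  (WithLp.fstL 2 ℝ E F).contDiff

lemma contDiff_withLp_snd : ContDiff ℝ k fun z : WithLp 2 (E × F) => z.snd :=
  (WithLp.sndL 2 ℝ E F).contDiff

lemma ContDiffAt.withLp_toLp (hu : ContDiffAt ℝ k u x) (hv : ContDiffAt ℝ k v x) :
    ContDiffAt ℝ k (fun y => WithLp.toLp 2 (u y, v y)) x :=
  (WithLp.prodContinuousLinearEquiv 2 ℝ E F).symm.contDiff.contDiffAt.comp x (hu.prodMk hv)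

lemma fderiv_withLp_toLp_apply (hu : DifferentiableAt ℝ u x) (hv : DifferentiableAt ℝ v x)
    (d : X) : fderiv ℝ (fun y => WithLp.toLp 2 (u y, v y)) x d =
      WithLp.toLp 2 (fderiv ℝ u x d, fderiv ℝ v x d) := by
  have h : HasFDerivAt (fun y => WithLp.toLp 2 (u y, v y)) _ x :=
    (WithLp.prodContinuousLinearEquiv 2 ℝ E F).symm.hasFDerivAt.comp x
      (hu.hasFDerivAt.prodMk hv.hasFDerivAt)
  rw [h.fderiv]; rfl

lemma fderiv_fderiv_withLp_toLp_apply (hu : Differentiable ℝ u)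
    (hu2 : DifferentiableAt ℝ (fderiv ℝ u) x) (L : X →L[ℝ] F) (b : F) (d d' : X) :
    fderiv ℝ (fderiv ℝ fun y => WithLp.toLp 2 (u y, L y - b)) x d d' =
      WithLp.toLp 2 (fderiv ℝ (fderiv ℝ u) x d d', 0) := by
  have e : (fderiv ℝ fun y => WithLp.toLp 2 (u y, L y - b)) = fun y =>
      ((WithLp.prodContinuousLinearEquiv 2 ℝ E F).symm : E × F →L[ℝ] WithLp 2 (E × F)).comp
        ((ContinuousLinearMap.inl ℝ E F).comp (fderiv ℝ u y) +
          (ContinuousLinearMap.inr ℝ E F).comp L) := by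
    ext1 y
    ext1 d
    rw [fderiv_withLp_toLp_apply (hu y) (L.differentiableAt.sub_const b), fderiv_clm_sub_const]
    simp [← WithLp.toLp_add]
  have h := (ContinuousLinearMap.compL ℝ X (E × F) (WithLp 2 (E × F))
    (WithLp.prodContinuousLinearEquiv 2 ℝ E F).symm).hasFDerivAt.comp x
    (((ContinuousLinearMap.compL ℝ X E (E × F) (ContinuousLinearMap.inl ℝ E F)).hasFDerivAt.comp x
      hu2.hasFDerivAt).add_const ((ContinuousLinearMap.inr ℝ E F).comp L))
  rw [e]
  exact congrArg (fun T : X →L[ℝ] X →L[ℝ] WithLp 2 (E × F) => T d d') h.fderiv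

end WithLpProd

/-! ### Jacobian and Hessian matrices as Fréchet derivatives. -/

section Coordinates

variable {n p : ℕ}

lemma EuclideanSpace.sum_smul_single (u : EuclideanSpace ℝ (Fin n)) :
    ∑ i, u i • EuclideanSpace.single i (1 : ℝ) = u := by
  ext k
  simp [Finset.sum_apply, Pi.single_apply]

lemma jacobianMatrix_mulVec (c : EuclideanSpace ℝ (Fin n) → EuclideanSpace ℝ (Fin p))
    (x u : EuclideanSpace ℝ (Fin n)) :
    jacobianMatrix c x *ᵥ u.ofLp = (fderiv ℝ c x u).ofLp := by
  ext j
  conv_rhs => rw [← EuclideanSpace.sum_smul_single u]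
  simp [jacobianMatrix, Matrix.mulVec, dotProduct, mul_comm]

lemma toEuclideanLin_jacobianMatrix
    (c : EuclideanSpace ℝ (Fin n) → EuclideanSpace ℝ (Fin p)) (x u : EuclideanSpace ℝ (Fin n)) :
    (jacobianMatrix c x).toEuclideanLin u = fderiv ℝ c x u := by
  rw [Matrix.toLpLin_apply, jacobianMatrix_mulVec]

lemma dotProduct_hessianMatrix_mulVec (g : EuclideanSpace ℝ (Fin n) → ℝ)
    (x u v : EuclideanSpace ℝ (Fin n)) :
    u.ofLp ⬝ᵥ (hessianMatrix g x *ᵥ v.ofLp) = fderiv ℝ (fderiv ℝ g) x u v := by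
  conv_rhs => rw [← EuclideanSpace.sum_smul_single u, ← EuclideanSpace.sum_smul_single v]
  simp only [hessianMatrix, Matrix.mulVec, dotProduct, Finset.mul_sum, map_sum, map_smul,
    sum_apply, smul_apply, Matrix.of_apply, smul_eq_mul]
  rw [Finset.sum_comm]
  exact Finset.sum_congr rfl fun i _ => Finset.sum_congr rfl fun j _ => by ring

lemma inner_toEuclideanLin_transpose (M : Matrix (Fin p) (Fin n) ℝ)
    (a : EuclideanSpace ℝ (Fin p)) (u : EuclideanSpace ℝ (Fin n)) :
    inner ℝ (Mᵀ.toEuclideanLin a) u = inner ℝ a (M.toEuclideanLin u) := by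
  rw [← Matrix.conjTranspose_eq_transpose_of_trivial, Matrix.toEuclideanLin_conjTranspose_eq_adjoint,
    LinearMap.adjoint_inner_left]

end Coordinates

/-! ### The split problem as an instance of the abstract one. -/

namespace SplitProblem

variable {n m p l : ℕ} (P : SplitProblem n m p l)

/-- The objective as a function of `(x, y)`. -/
def objective (z : PrimalPoint n m) : ℝ := P.f z.fst

/-- The residual `(c(x), Ax + By - b)` of the constraints. -/
noncomputable def residual (z : PrimalPoint n m) : DualPoint p l :=
  WithLp.toLp 2 (P.c z.fst, P.A.toEuclideanLin z.fst + P.B.toEuclideanLin z.snd - P.b)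

/-- The linear map `(x, y) ↦ Ax + By`. -/
noncomputable def linearPart : PrimalPoint n m →L[ℝ] EuclideanSpace ℝ (Fin l) :=
  (P.A.toEuclideanLin.toContinuousLinearMap).comp (WithLp.fstL 2 ℝ _ _) +
    (P.B.toEuclideanLin.toContinuousLinearMap).comp (WithLp.sndL 2 ℝ _ _)

lemma linearPart_apply (z : PrimalPoint n m) :
    P.linearPart z = P.A.toEuclideanLin z.fst + P.B.toEuclideanLin z.snd := rfl

/-- The value of the KKT map at the KKT points of the problem perturbed by `w`. -/
noncomputable def kktValue (m p : ℕ) (w : Perturbation n l) :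
    (PrimalPoint n m →L[ℝ] ℝ) × DualPoint p l :=
  (innerSL ℝ (WithLp.toLp 2 (w.fst, 0)), WithLp.toLp 2 (0, w.snd))

variable {P}

lemma contDiff_objective {k : WithTop ℕ∞} (hf : ContDiff ℝ k P.f) : ContDiff ℝ k P.objective :=
  hf.comp contDiff_withLp_fst

lemma contDiffAt_objective {k : WithTop ℕ∞} {z : PrimalPoint n m}
    (hf : ContDiffAt ℝ k P.f z.fst) : ContDiffAt ℝ k P.objective z :=
  ContDiffAt.comp z hf contDiff_withLp_fst.contDiffAt

lemma contDiffAt_residual {k : WithTop ℕ∞} {z : PrimalPoint n m}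
    (hc : ContDiffAt ℝ k P.c z.fst) : ContDiffAt ℝ k P.residual z :=
  (ContDiffAt.comp z hc contDiff_withLp_fst.contDiffAt).withLp_toLp
    (P.linearPart.contDiff.contDiffAt.sub contDiffAt_const)

lemma contDiff_residual {k : WithTop ℕ∞} (hc : ContDiff ℝ k P.c) : ContDiff ℝ k P.residual :=
  contDiff_iff_contDiffAt.2 fun _ => contDiffAt_residual hc.contDiffAt

lemma fderiv_objective_apply (hf : Differentiable ℝ P.f) (z d : PrimalPoint n m) :
    fderiv ℝ P.objective z d = fderiv ℝ P.f z.fst d.fst :=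
  congrArg (fun T : PrimalPoint n m →L[ℝ] ℝ => T d) (fderiv_comp_clm
    (WithLp.fstL 2 ℝ (EuclideanSpace ℝ (Fin n)) (EuclideanSpace ℝ (Fin m))) z hf)

lemma fderiv_residual_apply (hc : Differentiable ℝ P.c) (z d : PrimalPoint n m) :
    fderiv ℝ P.residual z d = WithLp.toLp 2 (fderiv ℝ P.c z.fst d.fst, P.linearPart d) := by
  have h1 : DifferentiableAt ℝ (fun z : PrimalPoint n m => P.c z.fst) z :=
    (hc z.fst).comp z (contDiff_withLp_fst.differentiable one_ne_zero z)
  have h2 : DifferentiableAt ℝ (fun z => P.linearPart z - P.b) z :=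
    P.linearPart.differentiableAt.sub_const P.b
  have h3 := fderiv_comp_clm
    (WithLp.fstL 2 ℝ (EuclideanSpace ℝ (Fin n)) (EuclideanSpace ℝ (Fin m))) z hc
  refine (fderiv_withLp_toLp_apply h1 h2 d).trans ?_
  rw [fderiv_clm_sub_const]
  exact congrArg (fun T : PrimalPoint n m →L[ℝ] EuclideanSpace ℝ (Fin p) =>
    WithLp.toLp 2 (T d, P.linearPart d)) h3

lemma mem_feasibleSet_perturb_iff (w : Perturbation n l) (z : PrimalPoint n m) :
    z ∈ (P.perturb w).feasibleSet ↔ P.residual z = WithLp.toLp 2 (0, w.snd) := by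
  rw [residual, (WithLp.toLp_injective 2).eq_iff, Prod.mk.injEq, sub_eq_iff_eq_add']
  rfl

lemma lagrangianDeriv_objective_residual_apply (hf : Differentiable ℝ P.f)
    (hc : Differentiable ℝ P.c) (z d : PrimalPoint n m) (η : DualPoint p l) :
    lagrangianDeriv P.objective P.residual (z, η) d = fderiv ℝ P.f z.fst d.fst +
      (inner ℝ η.fst (fderiv ℝ P.c z.fst d.fst) + inner ℝ η.snd (P.linearPart d)) := by
  rw [lagrangianDeriv_apply, fderiv_objective_apply hf, fderiv_residual_apply hc,
    WithLp.prod_inner_apply]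
  rfl

/-- The term `-rᵀx` shifts the derivative of the Lagrangian by a constant, and `q` shifts the
residual by a constant. Hence one map serves all perturbations, and the two stationarity equations
are the `x` and `y` components of one identity of functionals. -/
lemma isKKT_perturb_iff (hf : Differentiable ℝ P.f) (hc : Differentiable ℝ P.c)
    (w : Perturbation n l) (θ : PrimalDualPoint n m p l) :
    (P.perturb w).IsKKT θ ↔
      kktMap P.objective P.residual (θ.fst, θ.snd) = kktValue m p w := by
  have hgrad (u) : inner ℝ (gradient (P.perturb w).f θ.x) u =
      fderiv ℝ P.f θ.x u - inner ℝ w.fst u := by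
    rw [gradient, InnerProductSpace.toDual_symm_apply]
    have h : HasFDerivAt (P.perturb w).f _ θ.x :=
      (hf θ.x).hasFDerivAt.sub (innerSL ℝ w.fst).hasFDerivAt
    rw [h.fderiv]; rfl
  have hx : gradient (P.perturb w).f θ.x + (jacobianMatrix P.c θ.x)ᵀ.toEuclideanLin θ.mu
      + P.Aᵀ.toEuclideanLin θ.lam = 0 ↔ ∀ u, fderiv ℝ P.f θ.x u - inner ℝ w.fst u +
        inner ℝ θ.mu (fderiv ℝ P.c θ.x u) + inner ℝ θ.lam (P.A.toEuclideanLin u) = 0 := by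
    refine Iff.trans ⟨fun h v => by rw [h], ext_inner_right ℝ⟩ (forall_congr' fun u => ?_)
    simp_rw [inner_add_left, hgrad, inner_toEuclideanLin_transpose,
      toEuclideanLin_jacobianMatrix, inner_zero_left]
  have hy : P.Bᵀ.toEuclideanLin θ.lam = 0 ↔
      ∀ v, inner ℝ θ.lam (P.B.toEuclideanLin v) = 0 := by
    refine Iff.trans ⟨fun h v => by rw [h], ext_inner_right ℝ⟩ (forall_congr' fun v => ?_)
    simp_rw [inner_toEuclideanLin_transpose, inner_zero_left]
  have hL : lagrangianDeriv P.objective P.residual (θ.fst, θ.snd) =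
      innerSL ℝ (WithLp.toLp 2 (w.fst, 0)) ↔ ∀ d : PrimalPoint n m,
        fderiv ℝ P.f θ.x d.fst + (inner ℝ θ.mu (fderiv ℝ P.c θ.x d.fst) +
          inner ℝ θ.lam (P.A.toEuclideanLin d.fst + P.B.toEuclideanLin d.snd)) =
        inner ℝ w.fst d.fst := by
    rw [ContinuousLinearMap.ext_iff]
    refine forall_congr' fun d => ?_
    rw [lagrangianDeriv_objective_residual_apply hf hc, innerSL_apply_apply,
      WithLp.prod_inner_apply]
    simp [linearPart_apply]
  rw [kktMap, kktValue, Prod.mk.injEq, hL, ← mem_feasibleSet_perturb_iff]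
  constructor
  · rintro ⟨h1, h2, h3⟩
    refine ⟨fun d => ?_, h3⟩
    have h1' := hx.1 h1 d.fst
    have h2' := hy.1 h2 d.snd
    rw [inner_add_right]
    linarith
  · rintro ⟨h, h3⟩
    refine ⟨hx.2 fun u => ?_, hy.2 fun v => ?_, h3⟩
    · have := h (WithLp.toLp 2 (u, 0))
      simp at this
      linarith
    · simpa using h (WithLp.toLp 2 (0, v))

lemma perturb_zero : P.perturb 0 = P := by
  simp [perturb]

lemma contDiff_kktValue : ContDiff ℝ 1 (kktValue m p : Perturbation n l → _) := by
  have h1 : ContDiff ℝ 1 fun w : Perturbation n l =>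
      (WithLp.toLp 2 (w.fst, 0) : PrimalPoint n m) :=
    contDiff_iff_contDiffAt.2 fun _ => contDiff_withLp_fst.contDiffAt.withLp_toLp contDiffAt_const
  have h2 : ContDiff ℝ 1 fun w : Perturbation n l =>
      (WithLp.toLp 2 (0, w.snd) : DualPoint p l) :=
    contDiff_iff_contDiffAt.2 fun _ => contDiffAt_const.withLp_toLp contDiff_withLp_snd.contDiffAt
  exact ((innerSL ℝ (E := PrimalPoint n m)).contDiff.comp h1).prodMk h2

/-- The perturbation is recovered from the value of the KKT map by a continuous map. -/
lemma exists_continuous_leftInverse_kktValue : ∃ ψ : (PrimalPoint n m →L[ℝ] ℝ) × DualPoint p l →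
    Perturbation n l, Continuous ψ ∧ ∀ w, ψ (kktValue m p w) = w := by
  refine ⟨fun v => WithLp.toLp 2
    (((InnerProductSpace.toDual ℝ (PrimalPoint n m)).symm v.1).fst, v.2.snd), ?_, fun w => ?_⟩
  · refine (WithLp.prodContinuousLinearEquiv 2 ℝ _ _).symm.continuous.comp ?_
    refine Continuous.prodMk ((WithLp.fstL 2 ℝ _ _).continuous.comp ?_)
      ((WithLp.sndL 2 ℝ _ _).continuous.comp continuous_snd)
    exact (LinearIsometryEquiv.continuous _).comp continuous_fst
  · have : (InnerProductSpace.toDual ℝ (PrimalPoint n m)).symm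
        (innerSL ℝ (WithLp.toLp 2 (w.fst, 0))) = WithLp.toLp 2 (w.fst, 0) :=
      (InnerProductSpace.toDual ℝ (PrimalPoint n m)).symm_apply_apply _
    simp only [kktValue, this]
    rfl

lemma constraintJacobian_mulVec (P : SplitProblem n m p l) (x : EuclideanSpace ℝ (Fin n))
    (d : PrimalPoint n m) :
    P.constraintJacobian x *ᵥ Sum.elim d.fst.ofLp d.snd.ofLp =
      Sum.elim (fderiv ℝ P.c x d.fst).ofLp (P.linearPart d).ofLp := by
  rw [constraintJacobian, Matrix.fromBlocks_mulVec, Sum.elim_comp_inl, Sum.elim_comp_inr,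
    jacobianMatrix_mulVec, Matrix.zero_mulVec, add_zero]
  rfl

lemma fderiv_fderiv_objective_apply (hf : Differentiable ℝ P.f) {z : PrimalPoint n m}
    (hf2 : DifferentiableAt ℝ (fderiv ℝ P.f) z.fst) (d : PrimalPoint n m) :
    fderiv ℝ (fderiv ℝ P.objective) z d d = fderiv ℝ (fderiv ℝ P.f) z.fst d.fst d.fst :=
  fderiv_fderiv_comp_clm_apply (WithLp.fstL 2 ℝ (EuclideanSpace ℝ (Fin n))
    (EuclideanSpace ℝ (Fin m))) hf hf2 d d

lemma fderiv_fderiv_residual_apply (hc : ContDiff ℝ 1 P.c) {z : PrimalPoint n m}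
    (hc2 : ContDiffAt ℝ 2 P.c z.fst) (d : PrimalPoint n m) :
    fderiv ℝ (fderiv ℝ P.residual) z d d =
      WithLp.toLp 2 (fderiv ℝ (fderiv ℝ P.c) z.fst d.fst d.fst, 0) := by
  have hu : Differentiable ℝ fun z : PrimalPoint n m => P.c z.fst :=
    (hc.comp contDiff_withLp_fst).differentiable one_ne_zero
  have hu2 : DifferentiableAt ℝ (fderiv ℝ fun z : PrimalPoint n m => P.c z.fst) z :=
    ((ContDiffAt.comp z hc2 contDiff_withLp_fst.contDiffAt).fderiv_right (m := 1)
      (by norm_num)).differentiableAt one_ne_zero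
  refine (fderiv_fderiv_withLp_toLp_apply hu hu2 P.linearPart P.b d d).trans ?_
  have h : fderiv ℝ (fderiv ℝ fun z : PrimalPoint n m => P.c z.fst) z d d = _ :=
    fderiv_fderiv_comp_clm_apply (WithLp.fstL 2 ℝ (EuclideanSpace ℝ (Fin n))
      (EuclideanSpace ℝ (Fin m))) (hc.differentiable one_ne_zero)
      ((hc2.fderiv_right (m := 1) (by norm_num)).differentiableAt one_ne_zero) d d
  rw [h]
  rfl

/-! ### Matrix regularity assumptions in derivative form. -/

namespace IsRegularAt

variable {θs : PrimalDualPoint n m p l}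

lemma contDiffAt_f (hreg : P.IsRegularAt θs) : ContDiffAt ℝ 2 P.f θs.x := by
  obtain ⟨U, hU, hx, h, -⟩ := hreg.contDiffOn_two
  exact h.contDiffAt (hU.mem_nhds hx)

lemma contDiffAt_c (hreg : P.IsRegularAt θs) : ContDiffAt ℝ 2 P.c θs.x := by
  obtain ⟨U, hU, hx, -, h⟩ := hreg.contDiffOn_two
  exact h.contDiffAt (hU.mem_nhds hx)

/-- Orthogonality to the range of the derivative says that `e` is the coefficient vector of a
vanishing combination of rows of the constraint Jacobian. -/
lemma eq_zero_of_forall_inner_fderiv_residual_eq_zero (hreg : P.IsRegularAt θs) (e : DualPoint p l)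
    (he : ∀ u, inner ℝ e (fderiv ℝ P.residual θs.fst u) = 0) : e = 0 := by
  have hc := hreg.contDiff_c.differentiable one_ne_zero
  have hv : Sum.elim e.fst.ofLp e.snd.ofLp ᵥ* P.constraintJacobian θs.x = 0 := by
    refine dotProduct_eq_zero_iff.1 fun v => ?_
    rw [← Matrix.dotProduct_mulVec]
    have h := he (WithLp.toLp 2 (WithLp.toLp 2 (v ∘ Sum.inl), WithLp.toLp 2 (v ∘ Sum.inr)))
    rw [fderiv_residual_apply hc, WithLp.prod_inner_apply] at h
    have hm := constraintJacobian_mulVec P θs.x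
      (WithLp.toLp 2 (WithLp.toLp 2 (v ∘ Sum.inl), WithLp.toLp 2 (v ∘ Sum.inr)))
    have hs : Sum.elim (v ∘ Sum.inl) (v ∘ Sum.inr) = v := Sum.elim_comp_inl_inr v
    change P.constraintJacobian θs.x *ᵥ Sum.elim (v ∘ Sum.inl) (v ∘ Sum.inr) = _ at hm
    rw [hs] at hm
    rw [hm, sumElim_dotProduct_sumElim]
    simp only [PiLp.inner_apply, RCLike.inner_apply, conj_trivial] at h
    simp only [dotProduct, mul_comm (e.fst.ofLp _), mul_comm (e.snd.ofLp _)]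
    exact h
  have h0 := Matrix.vecMul_injective_iff.2 hreg.licq (hv.trans (Matrix.zero_vecMul _).symm)
  have h1 : e.fst = 0 := by ext i; exact congrFun h0 (Sum.inl i)
  have h2 : e.snd = 0 := by ext i; exact congrFun h0 (Sum.inr i)
  exact (WithLp.ofLp_injective 2) (Prod.ext h1 h2)

lemma dotProduct_lagrangianHessian_mulVec (hreg : P.IsRegularAt θs)
    (u : EuclideanSpace ℝ (Fin n)) :
    u.ofLp ⬝ᵥ (P.lagrangianHessian θs.x θs.mu *ᵥ u.ofLp) =
      fderiv ℝ (fderiv ℝ P.f) θs.x u u +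
        inner ℝ θs.mu (fderiv ℝ (fderiv ℝ P.c) θs.x u u) := by
  have h (j : Fin p) : fderiv ℝ (fderiv ℝ fun x => P.c x j) θs.x u u =
      fderiv ℝ (fderiv ℝ P.c) θs.x u u j :=
    fderiv_fderiv_clm_comp_apply (EuclideanSpace.proj j)
      (hreg.contDiff_c.differentiable one_ne_zero)
      ((hreg.contDiffAt_c.fderiv_right (m := 1) (by norm_num)).differentiableAt one_ne_zero) _ _
  simp only [lagrangianHessian, Matrix.add_mulVec, dotProduct_add, Matrix.sum_mulVec,
    dotProduct_sum, Matrix.smul_mulVec, dotProduct_smul, dotProduct_hessianMatrix_mulVec, h]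
  simp only [PiLp.inner_apply, RCLike.inner_apply, conj_trivial, smul_eq_mul,
    mul_comm (θs.mu _)]

/-- The objective does not involve `y` and the second constraint block is affine, so only the
curvature of `f` and `c` in `x` survives. -/
lemma lagrangianSecondDeriv_eq (hreg : P.IsRegularAt θs) (d : PrimalPoint n m) :
    lagrangianSecondDeriv P.objective P.residual (θs.fst, θs.snd) d d =
      d.fst.ofLp ⬝ᵥ (P.lagrangianHessian θs.x θs.mu *ᵥ d.fst.ofLp) := by
  rw [hreg.dotProduct_lagrangianHessian_mulVec, lagrangianSecondDeriv_apply,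
    fderiv_fderiv_objective_apply (hreg.contDiff_f.differentiable one_ne_zero)
      ((hreg.contDiffAt_f.fderiv_right (m := 1) (by norm_num)).differentiableAt one_ne_zero),
    fderiv_fderiv_residual_apply hreg.contDiff_c hreg.contDiffAt_c, WithLp.prod_inner_apply]
  change _ + (inner ℝ θs.mu (fderiv ℝ (fderiv ℝ P.c) θs.x d.fst d.fst) + inner ℝ θs.lam 0) = _
  rw [inner_zero_right, add_zero]

lemma lagrangianSecondDeriv_pos (hreg : P.IsRegularAt θs) (d : PrimalPoint n m) (hd : d ≠ 0)
    (hJ : fderiv ℝ P.residual θs.fst d = 0) :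
    0 < lagrangianSecondDeriv P.objective P.residual (θs.fst, θs.snd) d d := by
  have hc := hreg.contDiff_c.differentiable one_ne_zero
  rw [fderiv_residual_apply hc] at hJ
  have hJ1 : fderiv ℝ P.c θs.x d.fst = 0 := congrArg WithLp.fst hJ
  have hJ2 : P.linearPart d = 0 := congrArg WithLp.snd hJ
  have h := hreg.second_order (Sum.elim d.fst.ofLp d.snd.ofLp) (fun h0 => hd ?_) ?_
  · rw [hreg.lagrangianSecondDeriv_eq]
    rw [Matrix.fromBlocks_mulVec, sumElim_dotProduct_sumElim] at h
    simpa using h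
  · have h1 : d.fst = 0 := by ext i; exact congrFun h0 (Sum.inl i)
    have h2 : d.snd = 0 := by ext i; exact congrFun h0 (Sum.inr i)
    exact (WithLp.ofLp_injective 2) (Prod.ext h1 h2)
  · rw [constraintJacobian_mulVec, hJ1, hJ2]
    ext i; cases i <;> rfl

end IsRegularAt

end SplitProblem

/-! ### The estimate for perturbed problems, and the theorem. -/

namespace SplitProblem

variable {n m p l : ℕ} {P : SplitProblem n m p l}

/-- Lower estimate of the perturbed objective relative to a KKT point of the perturbed problem,
uniform near a regular KKT point. -/
lemma IsRegularAt.exists_objective_ge {θs : PrimalDualPoint n m p l} (hreg : P.IsRegularAt θs) :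
    ∃ K > 0, ∃ δ > 0, ∀ (w : Perturbation n l) (θ : PrimalDualPoint n m p l)
      (z : PrimalPoint n m) (q : EuclideanSpace ℝ (Fin l)), (P.perturb w).IsKKT θ →
      ‖θ.fst - θs.fst‖ < δ → ‖θ.snd - θs.snd‖ < δ → ‖z - θs.fst‖ < δ →
      P.residual z = WithLp.toLp 2 (0, q) →
      P.f θ.x - inner ℝ w.fst θ.x + inner ℝ θ.lam (w.snd - q) - K * ‖q - w.snd‖ ^ 2 ≤
        P.f z.fst - inner ℝ w.fst z.fst := by
  have hf := hreg.contDiff_f.differentiable one_ne_zero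
  have hc := hreg.contDiff_c.differentiable one_ne_zero
  obtain ⟨K, hK, δ, hδ, h⟩ := exists_lagrangian_ge (θ₀ := (θs.fst, θs.snd))
    ((contDiff_objective hreg.contDiff_f).differentiable one_ne_zero)
    ((contDiff_residual hreg.contDiff_c).differentiable one_ne_zero)
    (contDiffAt_objective hreg.contDiffAt_f) (contDiffAt_residual hreg.contDiffAt_c)
    hreg.lagrangianSecondDeriv_pos
  refine ⟨K, hK, δ, hδ, fun w θ z q hθ h1 h2 hz hq => ?_⟩
  have hkkt := (isKKT_perturb_iff hf hc w θ).1 hθ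
  have hL : lagrangianDeriv P.objective P.residual (θ.fst, θ.snd) =
    innerSL ℝ (WithLp.toLp 2 (w.fst, 0)) := congrArg Prod.fst hkkt
  have hr : P.residual θ.fst = WithLp.toLp 2 (0, w.snd) := congrArg Prod.snd hkkt
  -- The Lagrangian here is that of the unperturbed problem. Its derivative at `θ` is the pairing
  -- with `w.fst`, so the first-order term supplies the linear part of the perturbed objective.
  have h3 := h z θ.fst θ.snd hz h1 h2
  have hq' : ‖(WithLp.toLp 2 (0, q) : DualPoint p l) - WithLp.toLp 2 (0, w.snd)‖ ^ 2 =
      ‖q - w.snd‖ ^ 2 := by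
    rw [← WithLp.toLp_sub, Prod.mk_sub_mk, sub_zero, WithLp.prod_norm_sq_eq_of_L2]
    simp
  have hi (a : EuclideanSpace ℝ (Fin l)) :
      inner ℝ θ.snd (WithLp.toLp 2 (0, a)) = inner ℝ θ.lam a := by
    rw [WithLp.prod_inner_apply]
    change inner ℝ θ.mu 0 + inner ℝ θ.lam a = _
    rw [inner_zero_right, zero_add]
  have hj : innerSL ℝ (WithLp.toLp 2 (w.fst, 0) : PrimalPoint n m) (z - θ.fst) =
      inner ℝ w.fst z.fst - inner ℝ w.fst θ.x := by
    rw [innerSL_apply_apply, WithLp.prod_inner_apply]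
    change inner ℝ w.fst (z.fst - θ.x) + inner ℝ 0 (z - θ.fst).snd = _
    rw [inner_zero_left, add_zero, inner_sub_right]
  rw [hL, hr, hq, hq', hi, hi, hj] at h3
  rw [inner_sub_right]
  change P.f θ.x + _ + _ - _ ≤ P.f z.fst + _ at h3
  linarith

end SplitProblem

open Filter Topology in
theorem mainTheorem6 {n m p l : ℕ} (P : SplitProblem n m p l) (θs : PrimalDualPoint n m p l)
    (hreg : P.IsRegularAt θs) :
    ∃ ε₁ : ℝ, 0 < ε₁ ∧ ∃ θ : Perturbation n l → PrimalDualPoint n m p l,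
      -- Part 1: a continuously differentiable, locally unique map of KKT points
      (ContDiffOn ℝ 1 θ {w | ‖w‖ < ε₁} ∧
        (∀ w : Perturbation n l, ‖w‖ < ε₁ → (P.perturb w).IsKKT (θ w)) ∧
        θ 0 = θs ∧
        ∃ ε₁' : ℝ, 0 < ε₁' ∧ ∀ (w : Perturbation n l) (θ' : PrimalDualPoint n m p l),
          (P.perturb w).IsKKT θ' → ‖θ' - θs‖ < ε₁' → ‖w‖ < ε₁ ∧ θ' = θ w) ∧
      -- Part 2: the primal part is a minimizer on a neighborhood of uniform radius
      (∃ ε₂ : ℝ, 0 < ε₂ ∧ ε₂ ≤ ε₁ ∧ ∃ ε₂' : ℝ, 0 < ε₂' ∧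
        ∀ w : Perturbation n l, ‖w‖ < ε₂ →
          (P.perturb w).IsMinimizerOnNhd ε₂' (θ w).primal) ∧
      -- Part 3: the lower bound on the objective value at the unperturbed solution
      (∃ ρ' : ℝ, 0 < ρ' ∧ ∃ ε₃ : ℝ, 0 < ε₃ ∧ ε₃ ≤ ε₁ ∧
        ∀ w : Perturbation n l, ‖w‖ < ε₃ → ∀ ρ : ℝ, ρ' < ρ →
          P.f θs.x - inner ℝ w.fst θs.x ≥
            P.f (θ w).x - inner ℝ w.fst (θ w).x - ρ / 8 * ‖w.snd‖ ^ 2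
              + inner ℝ (θ w).lam w.snd) := by
  have hf := hreg.contDiff_f.differentiable one_ne_zero
  have hc := hreg.contDiff_c.differentiable one_ne_zero
  have hkkt0 : kktMap P.objective P.residual (θs.fst, θs.snd) =
      SplitProblem.kktValue m p (0 : Perturbation n l) :=
    (SplitProblem.isKKT_perturb_iff hf hc 0 θs).1 (by
      rw [SplitProblem.perturb_zero]; exact hreg.isKKT)
  obtain ⟨φ, hφ, hφ0, hright, hleft⟩ := exists_localInverse_kktMap (θ₀ := (θs.fst, θs.snd))
    (SplitProblem.contDiffAt_objective hreg.contDiffAt_f)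
    (SplitProblem.contDiffAt_residual hreg.contDiffAt_c)
    hreg.eq_zero_of_forall_inner_fderiv_residual_eq_zero hreg.lagrangianSecondDeriv_pos
  obtain ⟨ψ, hψ, hψl⟩ := SplitProblem.exists_continuous_leftInverse_kktValue
    (n := n) (m := m) (p := p) (l := l)
  obtain ⟨K, hK, δ, hδ, hest⟩ := hreg.exists_objective_ge
  have hval : Tendsto (SplitProblem.kktValue m p : Perturbation n l → _) (𝓝 0)
      (𝓝 (kktMap P.objective P.residual (θs.fst, θs.snd))) := by
    rw [hkkt0]
    exact SplitProblem.contDiff_kktValue.continuous.tendsto 0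
  have hθ_smooth (w : Perturbation n l) (hw : ContDiffAt ℝ 1 φ (SplitProblem.kktValue m p w)) :
      ContDiffAt ℝ 1 (fun w => WithLp.toLp 2 (φ (SplitProblem.kktValue m p w))) w := by
    have h := hw.comp w SplitProblem.contDiff_kktValue.contDiffAt
    exact ContDiffAt.withLp_toLp h.fst h.snd
  set θ : Perturbation n l → PrimalDualPoint n m p l :=
    fun w => WithLp.toLp 2 (φ (SplitProblem.kktValue m p w)) with hθ
  have hθ0 : θ 0 = θs := by
    simp only [hθ]
    rw [← hkkt0, hφ0]
    rfl
  have hφ_ev := hval.eventually (hφ.eventually (by simp))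
  have hcont : Tendsto θ (𝓝 0) (𝓝 θs) := by
    have := (hθ_smooth 0 hφ_ev.self_of_nhds).continuousAt.tendsto
    rwa [hθ0] at this
  obtain ⟨ε₁, hε₁, h1⟩ := Metric.eventually_nhds_iff.1 (hφ_ev.and (hval.eventually hright))
  simp only [dist_zero_right] at h1
  have hKKT (w : Perturbation n l) (hw : ‖w‖ < ε₁) : (P.perturb w).IsKKT (θ w) :=
    (SplitProblem.isKKT_perturb_iff hf hc w (θ w)).2 (h1 hw).2
  -- Half of `δ` bounds the drift of the KKT point; the other half is the radius of the ball in the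
  -- minimality claim.
  obtain ⟨ε₂, hε₂, h2⟩ := Metric.eventually_nhds_iff.1
    (hcont.eventually (Metric.ball_mem_nhds θs (half_pos hδ)))
  simp only [dist_zero_right] at h2
  have hfst (w : Perturbation n l) (hw : ‖w‖ < ε₂) : ‖(θ w).fst - θs.fst‖ < δ / 2 :=
    (WithLp.norm_fst_le _ (θ w - θs)).trans_lt (h2 hw)
  have hsnd (w : Perturbation n l) (hw : ‖w‖ < ε₂) : ‖(θ w).snd - θs.snd‖ < δ :=
    ((WithLp.norm_snd_le _ (θ w - θs)).trans_lt (h2 hw)).trans (half_lt_self hδ)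
  refine ⟨ε₁, hε₁, θ, ⟨fun w hw => (hθ_smooth w (h1 hw).1).contDiffWithinAt, hKKT, hθ0, ?_⟩,
    ⟨min ε₁ ε₂, by positivity, min_le_left _ _, δ / 2, half_pos hδ, fun w hw => ?_⟩,
    8 * K, by positivity, min ε₁ ε₂, by positivity, min_le_left _ _, fun w hw ρ hρ => ?_⟩
  · have hF : ContinuousAt (kktMap P.objective P.residual) (θs.fst, θs.snd) :=
      (contDiffAt_kktMap (SplitProblem.contDiffAt_objective hreg.contDiffAt_f)
        (SplitProblem.contDiffAt_residual hreg.contDiffAt_c)).continuousAt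
    -- The bound on `‖w‖` must follow from `θ'` being close to `θs`. Since `ψ` recovers `w`
    -- continuously from the value of the KKT map at `θ'`, continuity at `θs`, where that value
    -- corresponds to `w = 0`, suffices.
    have hnorm : ∀ᶠ v in 𝓝 (θs.fst, θs.snd),
        ‖ψ (kktMap P.objective P.residual v)‖ < ε₁ := by
      refine ((hψ.continuousAt.comp hF).norm).eventually_lt continuousAt_const ?_
      rw [Function.comp_apply, hkkt0, hψl, norm_zero]
      exact hε₁
    have hlp : Tendsto (fun v : PrimalDualPoint n m p l => (v.fst, v.snd)) (𝓝 θs)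
        (𝓝 (θs.fst, θs.snd)) := (WithLp.prod_continuous_ofLp 2 _ _).tendsto θs
    obtain ⟨ε, hε, h⟩ := Metric.eventually_nhds_iff.1 (hlp.eventually (hleft.and hnorm))
    refine ⟨ε, hε, fun w θ' hθ' hd => ?_⟩
    obtain ⟨ha, hb⟩ := h (by rwa [dist_eq_norm])
    rw [(SplitProblem.isKKT_perturb_iff hf hc w θ').1 hθ'] at ha hb
    rw [hψl] at hb
    refine ⟨hb, ?_⟩
    simp only [hθ]
    rw [ha]
    rfl
  · obtain ⟨hw1, hw2⟩ := lt_min_iff.1 hw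
    refine ⟨(hKKT w hw1).feasible, fun z hz => ?_⟩
    have hzd : ‖z - θs.fst‖ < δ := by
      have h := norm_sub_le_norm_sub_add_norm_sub z (θ w).fst θs.fst
      have h' : ‖z - (θ w).fst‖ < δ / 2 := mem_ball_iff_norm.1 hz.2
      linarith [hfst w hw2]
    have h := hest w (θ w) z w.snd (hKKT w hw1) ((hfst w hw2).trans (half_lt_self hδ))
      (hsnd w hw2) hzd ((SplitProblem.mem_feasibleSet_perturb_iff w z).1 hz.1)
    rw [sub_self, inner_zero_right, norm_zero] at h
    change P.f (θ w).x - inner ℝ w.fst (θ w).x ≤ P.f z.fst - inner ℝ w.fst z.fst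
    linarith
  · obtain ⟨hw1, hw2⟩ := lt_min_iff.1 hw
    -- The comparison point is feasible for the unperturbed problem, so its residual parameter is
    -- `0`. The loss is `K ‖w.snd‖²`, at most `ρ / 8 * ‖w.snd‖²` because `8 * K < ρ`.
    have h := hest w (θ w) θs.fst 0 (hKKT w hw1) ((hfst w hw2).trans (half_lt_self hδ))
      (hsnd w hw2) (by simpa using hδ) (congrArg Prod.snd hkkt0)
    rw [sub_zero, zero_sub, norm_neg] at h
    have := mul_le_mul_of_nonneg_right hρ.le (sq_nonneg ‖w.snd‖)
    change _ ≤ P.f θs.x - inner ℝ w.fst θs.x at h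
    linarith
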